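/- Let $E$ be an elliptic curve over $\mathbb{C}$, given by a Weierstrass equation $y^2+a_1xy+a_3y=x^3+a_2x^2+a_4x+a_6$ with $a_i\in\mathbb{C}$ and nonzero discriminant, and let $E(\mathbb{C})$ be the abelian group of its complex points, including the point at infinity $\mathcal{O}$ as the identity, under chord-and-tangent addition. For a natural number $n$ let $E[n]=\{P\in E(\mathbb{C}) : nP=\mathcal{O}\}$. 1. For every integer $n\ge 1$ there is an isomorphism of abelian groups $E[n]\cong \mathbb{Z}/n\mathbb{Z}\oplus\mathbb{Z}/n\mathbb{Z}$. 2. For every prime $\ell$, the group $E[\ell]$, with scalar multiplication modulo $\ell$, is an $\mathbb{F}_\ell$-vector space of dimension $2$. -/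

import Mathlib

/-- The `n`-torsion subgroup `E[n] = {P ∈ E(ℂ) : n • P = 𝓞}` of the group of complex points (the
affine points and the point at infinity, with the chord-and-tangent addition) of a Weierstrass
curve `E` over `ℂ`. -/
noncomputable abbrev WeierstrassCurve.complexTorsion (E : WeierstrassCurve ℂ) (n : ℕ) :
    AddSubgroup E.toAffine.Point :=
  AddSubgroup.torsionBy E.toAffine.Point (n : ℤ)

/-- Membership in `E[n]` unfolds to `n • P = 0`. -/
theorem WeierstrassCurve.mem_complexTorsion (E : WeierstrassCurve ℂ) (n : ℕ)
    (P : E.toAffine.Point) : P ∈ E.complexTorsion n ↔ n • P = 0 := by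
  simp [WeierstrassCurve.complexTorsion]

/-- Scalar multiplication modulo `n` makes `E[n]` a `ℤ/nℤ`-module. -/
noncomputable instance WeierstrassCurve.complexTorsionModule (E : WeierstrassCurve ℂ) (n : ℕ) :
    Module (ZMod n) (E.complexTorsion n) :=
  AddSubgroup.torsionBy.zmodModule

/-- The class of `k` modulo `n` acts on `E[n]` as multiplication by `k`. -/
theorem WeierstrassCurve.intCast_smul_complexTorsion (E : WeierstrassCurve ℂ) (n : ℕ) (k : ℤ)
    (P : E.complexTorsion n) : (k : ZMod n) • P = k • P :=
  Int.cast_smul_eq_zsmul (ZMod n) k P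

/-! ### The x-coordinates of P + Q and P - Q. -/

namespace WeierstrassCurve

/-! It suffices to show that E has exactly d² points killed by d for every d ≥ 1. A group of
exponent dividing n with d² elements killed by each d ∣ n is (ℤ/n)², by
`AddCommGroup.nonempty_addEquiv_zmod_prod_zmod`.

For the count (`card_ker_nsmul`), multiplication by n acts on x-coordinates as a fraction F/G of
degree n² (`exists_isMulByX`), built by recursion from the formula for the unordered pair x(P + Q),
x(P - Q). In characteristic zero a generic value c is taken at n² distinct x. If Q ≠ -Q lies over c,
each such x carries exactly one P with nP = Q, so this fibre, a coset of E[n], has n² points. -/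

theorem eval_addSubMap {R : Type*} [CommRing R] (W : WeierstrassCurve R) (s t u : R) :
    (fun i ↦ (W.addSubMap i).eval ![s, t, u]) =
      ![s ^ 2 - W.b₄ * s * u - W.b₆ * t * u - W.b₈ * u ^ 2,
        2 * t * s + W.b₂ * s * u + W.b₄ * t * u + W.b₆ * u ^ 2,
        t ^ 2 - 4 * s * u] := by
  ext i
  fin_cases i <;> simp [addSubMap]

namespace Affine.Point

variable {K : Type*} [Field K] [DecidableEq K] {W : WeierstrassCurve K}

theorem exists_addSubMap_some_of_X_ne {x₁ y₁ x₂ y₂ : K} (h₁ : W.toAffine.Nonsingular x₁ y₁)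
    (h₂ : W.toAffine.Nonsingular x₂ y₂) (hx : x₁ ≠ x₂) :
    ∃ c : K, (fun i ↦ (W.addSubMap i).eval ((some _ _ h₁).sym2x (some _ _ h₂))) =
      c • (some _ _ h₁ + some _ _ h₂).sym2x (some _ _ h₁ + -some _ _ h₂) := by
  have e₁ := (equation_iff' ..).mp h₁.1
  have e₂ := (equation_iff' ..).mp h₂.1
  -- The factor is the last coordinate t² - 4su at (x₁x₂, x₁ + x₂, 1); the right-hand triple ends in
  -- 1.
  refine ⟨(x₁ - x₂) ^ 2, ?_⟩
  have hx' := sub_ne_zero.mpr hx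
  rw [neg_some, add_of_X_ne hx, add_of_X_ne hx, sym2x_some_some,
    sym2x_some_some, eval_addSubMap, slope_of_X_ne hx, slope_of_X_ne hx]
  ext i
  fin_cases i
  · simp [addX, negY, b₂, b₄, b₆, b₈]
    field_simp
    grind
  · simp [addX, negY, b₂, b₄, b₆, b₈]
    field_simp
    linear_combination -2 * e₁ - 2 * e₂
  · simp
    ring

theorem exists_addSubMap_some_self {x y : K} (h : W.toAffine.Nonsingular x y) :
    ∃ c : K, (fun i ↦ (W.addSubMap i).eval ((some _ _ h).sym2x (some _ _ h))) =
      c • (some _ _ h + some _ _ h).sym2x 0 := by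
  have e := (equation_iff' ..).mp h.1
  by_cases hy : y = W.toAffine.negY x y
  · rw [add_self_of_Y_eq hy, sym2x_zero_zero, sym2x_some_some, eval_addSubMap]
    refine ⟨(x * x) ^ 2 - W.b₄ * (x * x) - W.b₆ * (x + x) - W.b₈, ?_⟩
    ext i
    fin_cases i
    · simp
    · simp [b₂, b₄, b₆]
      rw [negY] at hy
      linear_combination (-4) * e + (2 * y + W.a₁ * x + W.a₃) * hy
    · simp
      ring
  · rw [add_self_of_Y_ne hy, sym2x_some_zero, sym2x_some_some, eval_addSubMap,
      slope_of_Y_ne rfl hy]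
    have hy' := sub_ne_zero.mpr hy
    generalize hd : y - W.toAffine.negY x y = d at hy' ⊢
    rw [negY] at hd
    -- On the curve d² is the denominator of the duplication formula.
    refine ⟨d ^ 2, ?_⟩
    ext i
    fin_cases i
    · simp [addX]
      field_simp
      simp [b₄, b₆, b₈]
      grind
    · simp [b₂, b₄, b₆, ← hd]
      linear_combination (-4) * e
    · simp
      ring

/-- The map `addSubMap` sends the unordered pair of `x`-coordinates of `P` and `Q` to that of `P + Q`
and `P - Q`. -/
theorem exists_addSubMap_sym2x [W.IsElliptic] (P Q : W.toAffine.Point) :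
    ∃ c : K, c ≠ 0 ∧ (fun i ↦ (W.addSubMap i).eval (P.sym2x Q)) = c • (P + Q).sym2x (P - Q) := by
  suffices h : ∃ c : K,
      (fun i ↦ (W.addSubMap i).eval (P.sym2x Q)) = c • (P + Q).sym2x (P - Q) by
    obtain ⟨c, hc⟩ := h
    refine ⟨c, ?_, hc⟩
    rintro rfl
    exact W.addSubMap_ne_zero (sym2x_ne_zero P Q) (by simpa using hc)
  rcases P with _ | ⟨x₁, y₁, h₁⟩
  · rw [← zero_def, zero_add, zero_sub, sym2x_neg_right]
    rcases Q with _ | ⟨x₂, y₂, h₂⟩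
    · refine ⟨1, ?_⟩
      rw [← zero_def, sym2x_zero_zero, eval_addSubMap]
      simp
    · refine ⟨1, ?_⟩
      rw [sym2x_zero_some, sym2x_some_some, eval_addSubMap]
      ext i; fin_cases i <;> simp <;> ring
  · rcases Q with _ | ⟨x₂, y₂, h₂⟩
    · refine ⟨1, ?_⟩
      rw [← zero_def, add_zero, sub_zero, sym2x_some_zero, sym2x_some_some, eval_addSubMap]
      ext i; fin_cases i <;> simp <;> ring
    · by_cases hx : x₁ = x₂
      · rcases X_eq_iff (h₁ := h₁) (h₂ := h₂).mp hx with h | h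
        · rw [h, sub_self]
          exact exists_addSubMap_some_self h₂
        · rw [h, neg_add_cancel, sym2x_neg_left, sym2x_comm 0, sub_eq_add_neg, ← neg_add,
            sym2x_neg_left]
          exact exists_addSubMap_some_self h₂
      · rw [sub_eq_add_neg]
        exact exists_addSubMap_some_of_X_ne h₁ h₂ hx

end Affine.Point

end WeierstrassCurve

/-! ### Multiplication by n on x-coordinates. -/

namespace WeierstrassCurve

open Polynomial

variable {K : Type*} [Field K] [DecidableEq K] (W : WeierstrassCurve K)

/-- The fraction `F / G`, in lowest terms, describes the action of multiplication by `n` on the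
`x`-coordinates of the affine points of `W`: it has degree `n ^ 2`, takes the value `∞` at `∞` (for
`n ≠ 0`), and `(F (x) : G (x))` is the image of `n • P` in the projective line for every affine
point `P = (x, y)`. -/
structure IsMulByX (n : ℕ) (F G : K[X]) : Prop where
  monic : F.Monic
  natDegree : F.natDegree = n ^ 2
  degree_lt : G.degree < (n ^ 2 : ℕ)
  isCoprime : IsCoprime F G
  eval_eq : ∀ (x y : K) (h : W.toAffine.Nonsingular x y),
    ∃ c : K, c ≠ 0 ∧ ![F.eval x, G.eval x] = c • (n • Affine.Point.some x y h).xRep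

theorem isMulByX_zero : W.IsMulByX 0 1 0 where
  monic := monic_one
  natDegree := by simp
  degree_lt := by simp
  isCoprime := isCoprime_one_left
  eval_eq x y h := ⟨1, one_ne_zero, by simp⟩

theorem isMulByX_one : W.IsMulByX 1 X 1 where
  monic := monic_X
  natDegree := by simp
  degree_lt := by simp
  isCoprime := isCoprime_one_right
  eval_eq x y h := ⟨1, one_ne_zero, by simp⟩

/-- A binary quadratic form with polynomial coefficients vanishing at `(F, G)`, where `F` and `G`
are coprime, splits off the corresponding linear factor. -/
theorem _root_.Polynomial.exists_eq_mul_of_isCoprime {A₀ A₁ A₂ F G : K[X]} (hF : F ≠ 0)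
    (hFG : IsCoprime F G) (h : A₀ * G ^ 2 - A₁ * (F * G) + A₂ * F ^ 2 = 0) :
    ∃ F' G', A₀ = F * F' ∧ A₁ = F * G' + F' * G ∧ A₂ = G * G' := by
  obtain ⟨F', rfl⟩ : F ∣ A₀ := by
    refine (hFG.pow_right (n := 2)).dvd_of_dvd_mul_right ⟨A₁ * G - A₂ * F, ?_⟩
    linear_combination h
  have h' : F' * G ^ 2 - A₁ * G + A₂ * F = 0 :=
    mul_left_cancel₀ hF (by linear_combination h)
  obtain ⟨G', rfl⟩ : G ∣ A₂ := by
    refine hFG.symm.dvd_of_dvd_mul_right ⟨A₁ - F' * G, ?_⟩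
    linear_combination h'
  by_cases hG : G = 0
  · subst hG
    obtain ⟨G'', hG''⟩ := (isCoprime_zero_right.mp hFG).dvd (a := A₁)
    exact ⟨F', G'', rfl, by simpa using hG'', by simp⟩
  · exact ⟨F', G', rfl, mul_left_cancel₀ hG (by linear_combination -h'), rfl⟩

omit [DecidableEq K] in
theorem exists_nonsingular [IsAlgClosed K] [W.IsElliptic] (x : K) :
    ∃ y, W.toAffine.Nonsingular x y := by
  obtain ⟨y, hy⟩ := IsAlgClosed.exists_root
    (C 1 * X ^ 2 + C (W.a₁ * x + W.a₃) * X + C (-(x ^ 3 + W.a₂ * x ^ 2 + W.a₄ * x + W.a₆)))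
    (by rw [degree_quadratic one_ne_zero]; decide)
  refine ⟨y, Affine.equation_iff_nonsingular.mp ((Affine.equation_iff' ..).mpr ?_)⟩
  simp at hy
  linear_combination hy

omit [DecidableEq K] in
/-- A linear form in two variables is determined by its product with a nonzero linear form. -/
theorem eq_and_eq_of_mul_eq {a b a' b' s t : K} (hst : s ≠ 0 ∨ t ≠ 0) (h₀ : s * a = s * a')
    (h₁ : s * b + a * t = s * b' + a' * t) (h₂ : t * b = t * b') : a = a' ∧ b = b' := by
  by_cases hs : s = 0
  · subst hs
    have ht := hst.resolve_left (not_not.mpr rfl)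
    exact ⟨mul_right_cancel₀ ht (by linear_combination h₁), mul_left_cancel₀ ht h₂⟩
  · have ha := mul_left_cancel₀ hs h₀
    subst ha
    exact ⟨rfl, mul_left_cancel₀ hs (by linear_combination h₁)⟩

variable {W}

/-- The values of `addSubMap` at the triple attached to `F / G` and the identity. -/
theorem IsMulByX.eval_addSubMap_eq [W.IsElliptic] {n : ℕ} {F G : K[X]} (h : W.IsMulByX (n + 1) F G)
    {x y : K} (hxy : W.toAffine.Nonsingular x y) :
    ∃ c : K, c ≠ 0 ∧ (fun i ↦ (W.addSubMap i).eval
      ![x * F.eval x, F.eval x + x * G.eval x, G.eval x]) =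
      c • ((n + 2) • Affine.Point.some x y hxy).sym2x (n • Affine.Point.some x y hxy) := by
  obtain ⟨c, hc, e⟩ := h.eval_eq x y hxy
  obtain ⟨d, hd, e'⟩ := Affine.Point.exists_addSubMap_sym2x
    ((n + 1) • Affine.Point.some x y hxy) (Affine.Point.some x y hxy)
  -- `addSubMap` is homogeneous of degree 2, so rescaling by c contributes c².
  refine ⟨c ^ 2 * d, by positivity, ?_⟩
  have e₀ := congrFun e 0
  have e₁ := congrFun e 1
  rw [← succ_nsmul, show (n + 1) • Affine.Point.some x y hxy - Affine.Point.some x y hxy =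
    n • Affine.Point.some x y hxy by rw [succ_nsmul, add_sub_cancel_right]] at e'
  rw [mul_smul, ← e', Affine.Point.sym2x, eval_addSubMap, eval_addSubMap]
  simp at e₀ e₁
  rw [e₀, e₁]
  ext i
  fin_cases i <;> simp <;> ring

/-- With P' = (n + 1)P, the pair P' + P, P' - P is (n + 2)P, nP. Its symmetric functions `A₀`, `A₁`,
`A₂` are the coefficients of a binary quadratic form; dividing out the known factor of nP leaves
that of (n + 2)P. -/
theorem IsMulByX.exists_add_two [IsAlgClosed K] [W.IsElliptic] {n : ℕ} {F₀ G₀ F₁ G₁ : K[X]}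
    (h₀ : W.IsMulByX n F₀ G₀) (h₁ : W.IsMulByX (n + 1) F₁ G₁) : ∃ F G, W.IsMulByX (n + 2) F G := by
  let A₀ := (X * F₁) ^ 2 - (C W.b₄ * (X * F₁) * G₁ + C W.b₆ * (F₁ + X * G₁) * G₁ + C W.b₈ * G₁ ^ 2)
  let A₁ := C 2 * (F₁ + X * G₁) * (X * F₁) + C W.b₂ * (X * F₁) * G₁ + C W.b₄ * (F₁ + X * G₁) * G₁ +
    C W.b₆ * G₁ ^ 2
  let A₂ := (F₁ + X * G₁) ^ 2 - C 4 * (X * F₁) * G₁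
  have hA {x y : K} (hxy : W.toAffine.Nonsingular x y) :
      ∃ c : K, c ≠ 0 ∧ ![A₀.eval x, A₁.eval x, A₂.eval x] =
        c • ((n + 2) • Affine.Point.some x y hxy).sym2x (n • Affine.Point.some x y hxy) := by
    obtain ⟨c, hc, e⟩ := h₁.eval_addSubMap_eq hxy
    refine ⟨c, hc, e ▸ ?_⟩
    rw [eval_addSubMap]
    ext i
    fin_cases i <;> simp [A₀, A₁, A₂] <;> ring
  obtain ⟨F, G, e₀', e₁', e₂'⟩ : ∃ F G, A₀ = F₀ * F ∧ A₁ = F₀ * G + F * G₀ ∧ A₂ = G₀ * G := by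
    -- The form vanishes at (F₀ : G₀) for every x, hence identically, since K is infinite.
    refine exists_eq_mul_of_isCoprime h₀.monic.ne_zero h₀.isCoprime (Polynomial.funext fun x ↦ ?_)
    obtain ⟨y, hxy⟩ := W.exists_nonsingular x
    obtain ⟨c, -, e⟩ := hA hxy
    obtain ⟨d, -, e'⟩ := h₀.eval_eq x y hxy
    have e₀ := congrFun e 0
    have e₁ := congrFun e 1
    have e₂ := congrFun e 2
    have e₃ := congrFun e' 0
    have e₄ := congrFun e' 1
    simp [Affine.Point.sym2x] at e₀ e₁ e₂ e₃ e₄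
    simp only [eval_add, eval_sub, eval_mul, eval_pow, e₀, e₁, e₂, e₃, e₄, eval_zero]
    ring
  have heval (x y : K) (hxy : W.toAffine.Nonsingular x y) : ∃ c : K, c ≠ 0 ∧
      ![F.eval x, G.eval x] = c • ((n + 2) • Affine.Point.some x y hxy).xRep := by
    obtain ⟨c, hc, e⟩ := hA hxy
    obtain ⟨d, hd, e'⟩ := h₀.eval_eq x y hxy
    refine ⟨c / d, div_ne_zero hc hd, ?_⟩
    generalize n • Affine.Point.some x y hxy = S at e e'
    generalize (n + 2) • Affine.Point.some x y hxy = R at e ⊢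
    have hS := S.xRep_ne_zero
    have e₀ := congrFun e 0
    have e₁ := congrFun e 1
    have e₂ := congrFun e 2
    have e₃ := congrFun e' 0
    have e₄ := congrFun e' 1
    simp [Affine.Point.sym2x, e₀', e₁', e₂'] at e₀ e₁ e₂ e₃ e₄
    rw [e₃] at e₀ e₁
    rw [e₄] at e₁ e₂
    obtain ⟨hF, hG⟩ := eq_and_eq_of_mul_eq (s := d * S.xRep 0) (t := d * S.xRep 1)
      (a := F.eval x) (b := G.eval x) (a' := c / d * R.xRep 0) (b' := c / d * R.xRep 1)
      (by
        by_contra! h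
        simp only [mul_eq_zero, hd, false_or] at h
        exact hS (funext fun i ↦ by fin_cases i; exacts [h.1, h.2]))
      (by rw [e₀]; field_simp) (by rw [e₁]; field_simp; ring) (by rw [e₂]; field_simp)
    ext i
    fin_cases i
    exacts [hF, hG]
  have hFc : IsCoprime F G := by
    refine (isCoprime_iff_aeval_ne_zero_of_isAlgClosed _ K F G).mpr fun x ↦ ?_
    obtain ⟨y, hxy⟩ := W.exists_nonsingular x
    obtain ⟨c, hc, e⟩ := heval x y hxy
    by_contra! h
    simp only [coe_aeval_eq_eval] at h
    refine smul_ne_zero hc (Affine.Point.xRep_ne_zero _) (e.symm.trans ?_)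
    simp [h]
  obtain ⟨k, hk⟩ : ∃ k, (n + 1) ^ 2 = k + 1 := ⟨n ^ 2 + 2 * n, by ring⟩
  have hF₁ : F₁.natDegree = k + 1 := h₁.natDegree.trans hk
  have hG₁ : G₁.natDegree ≤ k := by
    by_cases hG₁ : G₁ = 0
    · simp [hG₁]
    · exact Nat.lt_succ_iff.mp (((natDegree_lt_iff_degree_lt hG₁).mpr h₁.degree_lt).trans_eq hk)
  have hs : (X * F₁).natDegree ≤ k + 2 := by
    rw [natDegree_X_mul h₁.monic.ne_zero, hF₁]
  have ht : (F₁ + X * G₁).natDegree ≤ k + 1 :=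
    natDegree_add_le_of_degree_le hF₁.le
      ((natDegree_mul_le_of_le natDegree_X_le hG₁).trans (by omega))
  have hb (b : K) {p q : K[X]} {i j : ℕ} (hp : p.natDegree ≤ i) (hq : q.natDegree ≤ j) :
      (C b * p * q).natDegree ≤ i + j :=
    natDegree_mul_le_of_le ((natDegree_C_mul_le b p).trans hp) hq
  have hb' (b : K) : (C b * G₁ ^ 2).natDegree ≤ k + k := by
    rw [pow_two, ← mul_assoc]
    exact hb b hG₁ hG₁
  -- The term (X F₁)² dominates, and 2k + 4 = n² + (n + 2)².
  have hA₀ : A₀.Monic ∧ A₀.natDegree = 2 * k + 4 := by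
    have hm : ((X * F₁) ^ 2).Monic := (monic_X.mul h₁.monic).pow 2
    have hd : ((X * F₁) ^ 2).natDegree = 2 * k + 4 := by
      rw [natDegree_pow, natDegree_X_mul h₁.monic.ne_zero, hF₁]; ring
    have hr : (C W.b₄ * (X * F₁) * G₁ + C W.b₆ * (F₁ + X * G₁) * G₁ +
        C W.b₈ * G₁ ^ 2).natDegree < 2 * k + 4 := by
      refine Nat.lt_succ_of_le (natDegree_add_le_of_degree_le (natDegree_add_le_of_degree_le
        ((hb _ hs hG₁).trans ?_) ((hb _ ht hG₁).trans ?_)) ((hb' _).trans ?_)) <;> omega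
    exact ⟨hm.sub_of_left (degree_lt_degree (by omega)),
      (natDegree_sub_eq_left_of_natDegree_lt (by omega)).trans hd⟩
  have hA₁ : A₁.natDegree ≤ 2 * k + 3 := by
    refine natDegree_add_le_of_degree_le (natDegree_add_le_of_degree_le
      (natDegree_add_le_of_degree_le ((hb _ ht hs).trans ?_) ((hb _ hs hG₁).trans ?_))
        ((hb _ ht hG₁).trans ?_)) ((hb' _).trans ?_) <;> omega
  have hFm : F.Monic := h₀.monic.of_mul_monic_left (e₀' ▸ hA₀.1)
  have hFd : F.natDegree = (n + 2) ^ 2 := by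
    have := hA₀.2
    rw [e₀', h₀.monic.natDegree_mul hFm, h₀.natDegree] at this
    nlinarith
  refine ⟨F, G, hFm, hFd, ?_, hFc, heval⟩
  have hG : (F₀ * G).degree < (2 * k + 4 : ℕ) := by
    rw [show F₀ * G = A₁ - F * G₀ from eq_sub_of_add_eq e₁'.symm]
    refine (degree_sub_le _ _).trans_lt (max_lt ?_ ?_)
    · exact (degree_le_of_natDegree_le hA₁).trans_lt (by norm_cast; omega)
    · rw [degree_mul, degree_eq_natDegree hFm.ne_zero, hFd]
      have := h₀.degree_lt
      by_cases hG₀ : G₀ = 0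
      · rw [hG₀, degree_zero, WithBot.add_bot]
        exact WithBot.bot_lt_coe _
      · rw [degree_eq_natDegree hG₀] at this ⊢
        norm_cast at this ⊢
        nlinarith
  by_cases hG' : G = 0
  · rw [hG', degree_zero]
    exact WithBot.bot_lt_coe _
  · rw [degree_mul, degree_eq_natDegree hG', degree_eq_natDegree h₀.monic.ne_zero,
      h₀.natDegree] at hG
    rw [degree_eq_natDegree hG']
    norm_cast at hG ⊢
    nlinarith

variable (W)

theorem exists_isMulByX [IsAlgClosed K] [W.IsElliptic] (n : ℕ) : ∃ F G, W.IsMulByX n F G := by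
  suffices h : (∃ F G, W.IsMulByX n F G) ∧ ∃ F G, W.IsMulByX (n + 1) F G from h.1
  induction n with
  | zero => exact ⟨⟨_, _, W.isMulByX_zero⟩, _, _, W.isMulByX_one⟩
  | succ n ih =>
    obtain ⟨⟨_, _, h₀⟩, _, _, h₁⟩ := ih
    exact ⟨⟨_, _, h₁⟩, h₀.exists_add_two h₁⟩

end WeierstrassCurve

/-! ### Recognising (ℤ/n)² by counting torsion. -/

/-- If `G` has exponent dividing `n` and exactly `d ^ 2` elements killed by `d`, for every divisor `d`
of `n`, then the quotient by the subgroup generated by an element of order `n` is cyclic. -/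
theorem AddCommGroup.isAddCyclic_quotient_zmultiples {G : Type*} [AddCommGroup G] [Finite G] {n : ℕ}
    (hn : n ≠ 0) (hG : ∀ g : G, n • g = 0)
    (hcard : ∀ d, d ∣ n → Nat.card (nsmulAddMonoidHom (α := G) d).ker = d ^ 2) {a : G}
    (ha : addOrderOf a = n) : IsAddCyclic (G ⧸ AddSubgroup.zmultiples a) := by
  classical
  have := Fintype.ofFinite (G ⧸ AddSubgroup.zmultiples a)
  refine isAddCyclic_of_card_nsmul_eq_zero_le fun m hm ↦ ?_
  obtain ⟨e, he⟩ := Nat.gcd_dvd_right m n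
  set d := m.gcd n
  have hd : 0 < d := Nat.gcd_pos_of_pos_left _ hm
  have he₀ : e ≠ 0 := by rintro rfl; exact hn (by simpa using he)
  let f := (QuotientAddGroup.mk' (AddSubgroup.zmultiples a)).comp
    (nsmulAddMonoidHom (α := G) d).ker.subtype
  -- The multiple e • a has order d and dies in the quotient.
  have hker : d ≤ Nat.card f.ker := by
    let c : (nsmulAddMonoidHom (α := G) d).ker := ⟨e • a, by
      simp [AddMonoidHom.mem_ker, ← mul_nsmul', ← he, hG]⟩
    have hc : addOrderOf c = d := by
      rw [← AddSubgroup.addOrderOf_coe, addOrderOf_nsmul_of_dvd he₀ (ha ▸ ⟨d, by rw [he, mul_comm]⟩),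
        ha, he, Nat.mul_div_cancel _ (Nat.pos_of_ne_zero he₀)]
    refine (hc.symm.trans (Nat.card_zmultiples c).symm).trans_le
      (AddSubgroup.card_le_of_le (AddSubgroup.zmultiples_le_of_mem ?_))
    exact (QuotientAddGroup.eq_zero_iff _).mpr (nsmul_mem (AddSubgroup.mem_zmultiples a) e)
  -- Every class killed by m is killed by d = gcd(m, n), and a representative can be shifted by a
  -- multiple of a until d kills it.
  have hrange : {q : G ⧸ AddSubgroup.zmultiples a | m • q = 0} ⊆ f.range := by
    intro q hq
    obtain ⟨g, rfl⟩ := QuotientAddGroup.mk_surjective q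
    have hnq : n • (g : G ⧸ AddSubgroup.zmultiples a) = 0 := by
      rw [← QuotientAddGroup.mk_nsmul, hG, QuotientAddGroup.mk_zero]
    have hdq : d • (g : G ⧸ AddSubgroup.zmultiples a) = 0 := gcd_nsmul_eq_zero.mpr ⟨hq, hnq⟩
    rw [← QuotientAddGroup.mk_nsmul, QuotientAddGroup.eq_zero_iff] at hdq
    obtain ⟨k, hk⟩ := AddSubgroup.mem_zmultiples_iff.mp hdq
    obtain ⟨l, rfl⟩ : (d : ℤ) ∣ k := by
      have h : (n : ℤ) ∣ e * k := by
        rw [← ha, addOrderOf_dvd_iff_zsmul_eq_zero, mul_zsmul, hk, natCast_zsmul, ← mul_nsmul',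
          mul_comm, ← he, hG]
      rw [he, Nat.cast_mul, mul_comm] at h
      exact (mul_dvd_mul_iff_left (by exact_mod_cast he₀)).mp h
    refine ⟨⟨g - l • a, ?_⟩, ?_⟩
    · rw [AddMonoidHom.mem_ker, nsmulAddMonoidHom_apply, nsmul_sub, ← hk, mul_zsmul, natCast_zsmul,
        sub_self]
    · have h : ((l • a : G) : G ⧸ AddSubgroup.zmultiples a) = 0 :=
        (QuotientAddGroup.eq_zero_iff _).mpr (zsmul_mem (AddSubgroup.mem_zmultiples a) l)
      simp only [f, AddMonoidHom.comp_apply, AddSubgroup.subtype_apply, QuotientAddGroup.mk'_apply,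
        QuotientAddGroup.mk_sub, h, sub_zero]
  have hprod : Nat.card f.range * Nat.card f.ker = d ^ 2 := by
    rw [← hcard d (Nat.gcd_dvd_right m n), ← AddSubgroup.index_ker, AddSubgroup.index_mul_card]
  have hle : Nat.card f.range ≤ d := by nlinarith
  calc _ = Nat.card {q : G ⧸ AddSubgroup.zmultiples a | m • q = 0} := by
        rw [Nat.card_eq_fintype_card, ← Set.toFinset_card]; congr 1; ext; simp
    _ ≤ Nat.card f.range := Nat.card_mono (Set.toFinite _) hrange
    _ ≤ d := hle
    _ ≤ m := Nat.gcd_le_left n hm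

/-- An abelian group of exponent dividing `n` with exactly `d ^ 2` elements killed by `d`, for every
divisor `d` of `n`, is isomorphic to `ℤ/nℤ ⊕ ℤ/nℤ`. -/
theorem AddCommGroup.nonempty_addEquiv_zmod_prod_zmod {G : Type*} [AddCommGroup G] {n : ℕ}
    (hn : n ≠ 0) (hG : ∀ g : G, n • g = 0)
    (hcard : ∀ d, d ∣ n → Nat.card (nsmulAddMonoidHom (α := G) d).ker = d ^ 2) :
    Nonempty (G ≃+ ZMod n × ZMod n) := by
  have htop {d : ℕ} (h : ∀ g : G, d • g = 0) :
      Nat.card (nsmulAddMonoidHom (α := G) d).ker = Nat.card G := by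
    rw [(AddSubgroup.eq_top_iff' (nsmulAddMonoidHom (α := G) d).ker).mpr h, AddSubgroup.card_top]
  have hGn : Nat.card G = n ^ 2 := (htop hG).symm.trans (hcard n dvd_rfl)
  have hfin : Finite G := Nat.finite_of_card_ne_zero (hGn ▸ pow_ne_zero 2 hn)
  have : NeZero n := ⟨hn⟩
  obtain ⟨a, ha⟩ := AddMonoid.exists_addOrderOf_eq_exponent
    (AddMonoid.ExponentExists.of_finite (G := G))
  -- The exponent kills all of G, so its square equals |G| = n².
  have hexp : AddMonoid.exponent G = n := by
    refine Nat.pow_left_injective two_ne_zero ?_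
    change _ ^ 2 = _ ^ 2
    rw [← hGn, ← hcard _ (AddMonoid.exponent_dvd_of_forall_nsmul_eq_zero hG),
      htop AddMonoid.exponent_nsmul_eq_zero]
  rw [hexp] at ha
  have hcyc := isAddCyclic_quotient_zmultiples hn hG hcard ha
  have hQ : Nat.card (G ⧸ AddSubgroup.zmultiples a) = n := by
    have := AddSubgroup.card_eq_card_quotient_mul_card_addSubgroup (AddSubgroup.zmultiples a)
    rw [hGn, Nat.card_zmultiples, ha, pow_two] at this
    exact (Nat.mul_right_cancel (Nat.pos_of_ne_zero hn) this).symm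
  -- Any lift b of a generator will do: n kills b, while b has order n already modulo a.
  obtain ⟨b', hb'⟩ := IsAddCyclic.exists_ofOrder_eq_natCard (α := G ⧸ AddSubgroup.zmultiples a)
  obtain ⟨b, rfl⟩ := QuotientAddGroup.mk_surjective b'
  rw [hQ] at hb'
  let φ (g : G) : ZMod n →+ G := ZMod.lift n ⟨zmultiplesHom G g, by simp [hG]⟩
  have hφ (g : G) (i : ℤ) : φ g i = i • g := by simp [φ]
  have hinj : Function.Injective ((φ a).coprod (φ b)) := by
    rw [injective_iff_map_eq_zero]
    rintro ⟨x, y⟩ hxy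
    obtain ⟨i, rfl⟩ := ZMod.intCast_surjective x
    obtain ⟨j, rfl⟩ := ZMod.intCast_surjective y
    rw [AddMonoidHom.coprod_apply, hφ, hφ] at hxy
    have hj : (n : ℤ) ∣ j := by
      rw [← hb', addOrderOf_dvd_iff_zsmul_eq_zero, ← QuotientAddGroup.mk_zsmul,
        QuotientAddGroup.eq_zero_iff, eq_neg_of_add_eq_zero_right hxy]
      exact neg_mem (zsmul_mem (AddSubgroup.mem_zmultiples a) i)
    have hi : (n : ℤ) ∣ i := by
      obtain ⟨k, rfl⟩ := hj
      rw [mul_zsmul, natCast_zsmul, hG, add_zero] at hxy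
      rwa [← ha, addOrderOf_dvd_iff_zsmul_eq_zero]
    simp [(ZMod.intCast_zmod_eq_zero_iff_dvd _ _).mpr, hi, hj]
  refine ⟨(AddEquiv.ofBijective _
    ((Nat.bijective_iff_injective_and_card _).mpr ⟨hinj, ?_⟩)).symm⟩
  rw [Nat.card_prod, Nat.card_zmod, hGn, pow_two]

/-! ### Counting the n-torsion points. -/

open Polynomial in
/-- A rational function `F / G` of degree `d` takes all but finitely many values exactly `d` times
in characteristic zero. -/
theorem Polynomial.exists_card_roots_sub_C_mul {K : Type*} [Field K] [DecidableEq K] [CharZero K]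
    [IsAlgClosed K] {F G : K[X]} (hF : F.Monic) (hG : G.degree < F.degree) (hFG : IsCoprime F G)
    (hd : F.natDegree ≠ 0) (S : Finset K) :
    ∃ c ∉ S, (F - C c * G).roots.toFinset.card = F.natDegree := by
  -- A multiple root of F - cG is a zero of this Wronskian, so only finitely many c are bad. If it
  -- were zero, F would divide F', forcing F' = 0.
  have hW : derivative F * G - F * derivative G ≠ 0 := fun h ↦ by
    have hdvd : F ∣ derivative F := hFG.dvd_of_dvd_mul_right ⟨derivative G, sub_eq_zero.mp h⟩
    exact hd (derivative_eq_zero.mp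
      (eq_zero_of_dvd_of_degree_lt hdvd (degree_derivative_lt hF.ne_zero)))
  obtain ⟨c, hc⟩ := Infinite.exists_notMem_finset
    (S ∪ (derivative F * G - F * derivative G).roots.toFinset.image fun x ↦ F.eval x / G.eval x)
  rw [Finset.mem_union, not_or] at hc
  refine ⟨c, hc.1, ?_⟩
  have hlt : (C c * G).degree < F.degree := (C_mul' c G ▸ degree_smul_le c G).trans_lt hG
  have hp : (F - C c * G) ≠ 0 := (hF.sub_of_left hlt).ne_zero
  have hnodup : (F - C c * G).roots.Nodup := by
    refine Multiset.nodup_iff_count_le_one.mpr fun x ↦ ?_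
    rw [count_roots]
    by_contra! h
    obtain ⟨h₀, h₁⟩ := (one_lt_rootMultiplicity_iff_isRoot hp).mp h
    simp only [IsRoot.def, eval_sub, eval_mul, eval_C, derivative_sub, derivative_C_mul,
      sub_eq_zero] at h₀ h₁
    have hGx : G.eval x ≠ 0 := fun hGx ↦ by
      have := aeval_ne_zero_of_isCoprime hFG x
      simp [h₀, hGx] at this
    refine hc.2 (Finset.mem_image.mpr ⟨x, ?_, by rw [h₀, mul_div_cancel_right₀ _ hGx]⟩)
    rw [Multiset.mem_toFinset, mem_roots hW, IsRoot.def, eval_sub, eval_mul, eval_mul, h₀, h₁]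
    ring
  rw [Multiset.toFinset_card_of_nodup hnodup, ← (IsAlgClosed.splits _).natDegree_eq_card_roots]
  exact natDegree_eq_of_degree_eq (degree_sub_eq_left_of_degree_lt hlt)

namespace WeierstrassCurve

open Polynomial

variable {K : Type*} [Field K] [DecidableEq K] {W : WeierstrassCurve K}

-- On the curve, `Ψ₂Sq` at x is the square of 2y + a₁x + a₃, the difference of the y-coordinates of
-- P and -P.
omit [DecidableEq K] in
theorem Affine.Point.some_ne_neg {x y : K} (h : W.toAffine.Nonsingular x y)
    (hx : ¬ W.Ψ₂Sq.IsRoot x) : Affine.Point.some x y h ≠ -Affine.Point.some x y h := fun he ↦ by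
  refine hx ?_
  rw [Affine.Point.neg_some] at he
  have hy := (Affine.Point.some.inj he).2
  rw [Affine.negY] at hy
  have e := (Affine.equation_iff' ..).mp h.1
  simp [Ψ₂Sq, b₂, b₄, b₆]
  linear_combination (-4) * e + (2 * y + W.a₁ * x + W.a₃) * hy

theorem IsMulByX.isRoot_sub_iff {n : ℕ} {F G : K[X]} (hFG : W.IsMulByX n F G) {x y c y' : K}
    (h : W.toAffine.Nonsingular x y) (h' : W.toAffine.Nonsingular c y') :
    (F - C c * G).IsRoot x ↔ n • Affine.Point.some x y h = Affine.Point.some c y' h' ∨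
      n • Affine.Point.some x y h = -Affine.Point.some c y' h' := by
  obtain ⟨d, hd, e⟩ := hFG.eval_eq x y h
  rw [← Affine.Point.xRep_eq_xRep_iff]
  have e₀ := congrFun e 0
  have e₁ := congrFun e 1
  generalize n • Affine.Point.some x y h = R at e₀ e₁ ⊢
  rcases R with _ | ⟨z, w, hz⟩
  · simp [← Affine.Point.zero_def] at e₀ e₁ ⊢
    simp [e₀, e₁, hd]
  · simp at e₀ e₁ ⊢
    rw [e₀, e₁, mul_comm c, ← mul_sub, mul_eq_zero, sub_eq_zero]
    simp [hd]

variable (W)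

/-- An elliptic curve over an algebraically closed field of characteristic zero has exactly `n ^ 2`
points killed by `n`. -/
theorem card_ker_nsmul [IsAlgClosed K] [CharZero K] [W.IsElliptic] {n : ℕ} (hn : n ≠ 0) :
    Nat.card (nsmulAddMonoidHom (α := W.toAffine.Point) n).ker = n ^ 2 := by
  obtain ⟨F, G, hFG⟩ := W.exists_isMulByX n
  have hd : F.natDegree ≠ 0 := hFG.natDegree ▸ pow_ne_zero 2 hn
  obtain ⟨c, hc, hcard⟩ := exists_card_roots_sub_C_mul hFG.monic
    (by rw [degree_eq_natDegree hFG.monic.ne_zero, hFG.natDegree]; exact hFG.degree_lt)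
    hFG.isCoprime hd W.Ψ₂Sq.roots.toFinset
  rw [hFG.natDegree] at hcard
  have hp : F - C c * G ≠ 0 := fun h ↦
    pow_ne_zero 2 hn (by simpa [h] using hcard.symm)
  obtain ⟨y', h'⟩ := W.exists_nonsingular c
  have hQ := Affine.Point.some_ne_neg h' fun h ↦ hc <|
    Multiset.mem_toFinset.mpr ((mem_roots (W.Ψ₂Sq_ne_zero (by norm_num))).mpr h)
  set Q := Affine.Point.some c y' h'
  -- A root x gives only nP = ±Q; negating P if needed fixes the sign, and Q ≠ -Q makes the choice
  -- unique.
  have hexists (x : (F - C c * G).roots.toFinset) :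
      ∃ y h, n • Affine.Point.some (W' := W.toAffine) x y h = Q := by
    have hx : (F - C c * G).IsRoot x := (mem_roots hp).mp (Multiset.mem_toFinset.mp x.2)
    obtain ⟨y, h⟩ := W.exists_nonsingular x
    rcases (hFG.isRoot_sub_iff h h').mp hx with h₁ | h₁
    · exact ⟨y, h, h₁⟩
    · refine ⟨W.toAffine.negY x y, (Affine.nonsingular_neg ..).mpr h, ?_⟩
      rw [← Affine.Point.neg_some h, smul_neg, h₁, neg_neg]
  have hunique (x y₁ y₂ : K) (h₁ : W.toAffine.Nonsingular x y₁) (h₂ : W.toAffine.Nonsingular x y₂)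
      (e₁ : n • Affine.Point.some x y₁ h₁ = Q) (e₂ : n • Affine.Point.some x y₂ h₂ = Q) :
      y₁ = y₂ := by
    rcases Affine.Point.X_eq_iff (h₁ := h₁) (h₂ := h₂).mp rfl with h | h
    · exact (Affine.Point.some.inj h).2
    · rw [h, smul_neg, e₂] at e₁
      exact absurd e₁.symm hQ
  choose Y hY hYQ using hexists
  obtain ⟨x₀⟩ : Nonempty (F - C c * G).roots.toFinset := by
    rw [Finset.nonempty_coe_sort, ← Finset.card_pos, hcard]
    positivity
  -- Subtracting a base point turns the fibre over Q into the kernel.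
  let f (x : (F - C c * G).roots.toFinset) : (nsmulAddMonoidHom (α := W.toAffine.Point) n).ker :=
    ⟨Affine.Point.some _ _ (hY x) - Affine.Point.some _ _ (hY x₀), by
      simp only [AddMonoidHom.mem_ker, nsmulAddMonoidHom_apply, smul_sub, hYQ, sub_self]⟩
  have hf : Function.Bijective f := by
    refine ⟨fun x x' h ↦ ?_, fun ⟨R, hR⟩ ↦ ?_⟩
    · exact Subtype.ext (Affine.Point.some.inj (sub_left_injective (Subtype.ext_iff.mp h))).1
    · have hR' : n • (R + Affine.Point.some _ _ (hY x₀)) = Q := by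
        rw [smul_add, hYQ, show n • R = 0 from hR, zero_add]
      suffices h : ∃ x, Affine.Point.some _ _ (hY x) = R + Affine.Point.some _ _ (hY x₀) by
        obtain ⟨x, hx⟩ := h
        exact ⟨x, Subtype.ext (sub_eq_of_eq_add hx)⟩
      generalize R + Affine.Point.some _ _ (hY x₀) = S at hR'
      rcases S with _ | ⟨x, y, h⟩
      · rw [← Affine.Point.zero_def, smul_zero] at hR'
        exact absurd hR'.symm (Affine.Point.some_ne_zero h')
      · have hx : x ∈ (F - C c * G).roots.toFinset := Multiset.mem_toFinset.mpr
          ((mem_roots hp).mpr ((hFG.isRoot_sub_iff h h').mpr (.inl hR')))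
        obtain rfl := hunique _ _ _ (hY ⟨x, hx⟩) h (hYQ ⟨x, hx⟩) hR'
        exact ⟨⟨x, hx⟩, rfl⟩
  rw [← hcard, ← Nat.card_congr (Equiv.ofBijective f hf), Nat.card_eq_fintype_card,
    Fintype.card_coe]

end WeierstrassCurve

/-! ### Conclusion over ℂ. -/

namespace WeierstrassCurve

theorem nonempty_complexTorsion_addEquiv (E : WeierstrassCurve ℂ) [E.IsElliptic] {n : ℕ}
    (hn : n ≠ 0) : Nonempty (E.complexTorsion n ≃+ ZMod n × ZMod n) := by
  refine AddCommGroup.nonempty_addEquiv_zmod_prod_zmod hn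
    (fun P ↦ Subtype.ext ((E.mem_complexTorsion n P).mp P.2)) fun d hd ↦ ?_
  rw [← E.card_ker_nsmul (ne_zero_of_dvd_ne_zero hn hd)]
  -- Since d ∣ n, the elements of E[n] killed by d are all of E[d].
  refine Nat.card_congr ⟨fun P ↦ ⟨P.1, congrArg Subtype.val P.2⟩,
    fun P ↦ ⟨⟨P, (E.mem_complexTorsion n P).mpr ?_⟩, Subtype.ext P.2⟩, fun _ ↦ rfl, fun _ ↦ rfl⟩
  obtain ⟨e, rfl⟩ := hd
  rw [mul_nsmul, show d • (P : E.toAffine.Point) = 0 from P.2]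
  exact nsmul_zero e

end WeierstrassCurve

theorem mainTheorem4 (E : WeierstrassCurve ℂ) [E.IsElliptic] :
    (∀ n : ℕ, 1 ≤ n → Nonempty (E.complexTorsion n ≃+ ZMod n × ZMod n)) ∧
      (∀ l : ℕ, l.Prime → Module.finrank (ZMod l) (E.complexTorsion l) = 2) := by
  refine ⟨fun n hn ↦ E.nonempty_complexTorsion_addEquiv (by omega), fun l hl ↦ ?_⟩
  have : Fact l.Prime := ⟨hl⟩
  obtain ⟨e⟩ := E.nonempty_complexTorsion_addEquiv hl.ne_zero
  -- Additive maps between ℤ/l-modules are automatically linear.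
  rw [(LinearEquiv.ofBijective (e.toAddMonoidHom.toZModLinearMap l) e.bijective).finrank_eq,
    Module.finrank_prod, Module.finrank_self]
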